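/- Let $P=\{p_1,\dots,p_n\}$ be a set of $n\ge 1$ distinct points in $\mathbb{R}^d$ and let $\alpha>0$. Each point is an agent. The strategy of agent $u$ is a set $S_u\subseteq P\setminus\{u\}$; a strategy profile $\mathbf{s}=(S_u)_{u\in P}$ creates the undirected network $G(\mathbf{s})$ on $P$ with edges $\{u,v\}$ for $v\in S_u$, each edge having its Euclidean length. The cost of $u$ is $\mathrm{cost}(u,G(\mathbf{s}))=\alpha\sum_{v\in S_u}\|u-v\|_2+\sum_{v\in P}d_{G(\mathbf{s})}(u,v)$, where $d_G$ is the shortest-path distance in $G$ ($+\infty$ if there is no path), and the social cost of $\mathbf{s}$ is the sum of the costs of all agents. The profile $\mathbf{s}$ (and its network) is a $(\beta,\gamma)$-network if no agent can, by changing only her own strategy, improve her cost by more than a factor of $\beta$, and the social cost of $\mathbf{s}$ is at most $\gamma$ times the minimum social cost over all strategy profiles. For every dimension $d$ there are a constant $C$ depending only on $d$ and a real-RAM algorithm (unit-cost arithmetic operations and comparisons on exact reals, natural-number arithmetic for indices, indirect addressing) such that, for all $n\ge1$, all sets $P$ of $n$ points in $\mathbb{R}^d$ and all $\alpha>0$,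 the algorithm with input $(P,\alpha)$ halts after at most $C n^2$ steps and outputs a strategy profile (as a list of owned edges) with the following property. For every real $x>0$ with $\alpha\le n^x$, the output is a $(\beta,\beta)$-network for some $$\beta\le C\left(\alpha^{1-\frac{1}{2x}}+1\right)\ \text{ if } x\ge 1,\qquad \beta\le C\left(\alpha^{\frac{3x-1}{4x}}+1\right)\ \text{ if } 0<x<1.$$ In particular, if $\alpha\le n^{1/3}$, the output is a $(\beta,\beta)$-network for some $\beta\le C$. -/

import Mathlib

open scoped ENNReal

/-! ## The Euclidean network creation game

The agents are `Fin n`; agent `u` sits at the point `P u` of `ℝ^d`, and `s u` is the set of agents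
towards which `u` buys an edge. -/

namespace NetworkCreation

variable {d n : ℕ}

/-- A strategy profile: no agent buys an edge to herself. -/
def IsStrategyProfile (s : Fin n → Finset (Fin n)) : Prop :=
  ∀ u, u ∉ s u

/-- The created network: `u` and `v` are joined when one of them buys the edge. -/
def network (s : Fin n → Finset (Fin n)) : SimpleGraph (Fin n) :=
  SimpleGraph.fromRel (fun u v => v ∈ s u)

/-- Total Euclidean length of a walk. -/
noncomputable def walkLength (P : Fin n → EuclideanSpace ℝ (Fin d)) {G : SimpleGraph (Fin n)}
    {u v : Fin n} (w : G.Walk u v) : ℝ≥0∞ :=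
  (w.darts.map (fun e => edist (P e.fst) (P e.snd))).sum

/-- The distance of `u` and `v` in `G`: the length of a shortest walk, and `∞` if there is none. -/
noncomputable def netDist (P : Fin n → EuclideanSpace ℝ (Fin d)) (G : SimpleGraph (Fin n))
    (u v : Fin n) : ℝ≥0∞ :=
  ⨅ w : G.Walk u v, walkLength P w

/-- Cost of agent `u`: `α` times the total length of the edges she buys, plus the sum of her
distances to all agents in the created network. -/
noncomputable def cost (P : Fin n → EuclideanSpace ℝ (Fin d)) (α : ℝ)
    (s : Fin n → Finset (Fin n)) (u : Fin n) : ℝ≥0∞ :=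
  ENNReal.ofReal α * (∑ v ∈ s u, edist (P u) (P v)) + ∑ v, netDist P (network s) u v

/-- Social cost of a strategy profile. -/
noncomputable def socialCost (P : Fin n → EuclideanSpace ℝ (Fin d)) (α : ℝ)
    (s : Fin n → Finset (Fin n)) : ℝ≥0∞ :=
  ∑ u, cost P α s u

/-- A strategy profile of minimum social cost. -/
def IsSocialOptimum (P : Fin n → EuclideanSpace ℝ (Fin d)) (α : ℝ)
    (s : Fin n → Finset (Fin n)) : Prop :=
  IsStrategyProfile s ∧ ∀ s', IsStrategyProfile s' → socialCost P α s ≤ socialCost P α s'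

/-- `β`-approximate Nash equilibrium: no agent can improve her cost by more than a factor `β` by
changing her own strategy. -/
def IsApproxNE (P : Fin n → EuclideanSpace ℝ (Fin d)) (α β : ℝ)
    (s : Fin n → Finset (Fin n)) : Prop :=
  IsStrategyProfile s ∧ ∀ (u : Fin n) (T : Finset (Fin n)), u ∉ T →
    cost P α s u ≤ ENNReal.ofReal β * cost P α (Function.update s u T) u

/-- `(β, γ)`-equilibrium: a `β`-approximate Nash equilibrium whose social cost is at most `γ` times
the social optimum. -/
def IsBetaGammaNE (P : Fin n → EuclideanSpace ℝ (Fin d)) (α β γ : ℝ)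
    (s : Fin n → Finset (Fin n)) : Prop :=
  IsApproxNE P α β s ∧
    ∃ sOpt, IsSocialOptimum P α sOpt ∧
      socialCost P α s ≤ ENNReal.ofReal γ * socialCost P α sOpt

end NetworkCreation

/-! ## Real RAM programs with a step count -/

namespace RealRAM

/-- Memory of the machine: natural-number registers and real registers (named by constants of the
program), and natural-number arrays and real arrays, addressed indirectly. -/
structure State where
  nreg : ℕ → ℕ
  rreg : ℕ → ℝ
  narr : ℕ → ℕ → ℕ
  rarr : ℕ → ℕ → ℝ

/-- Elementary instructions. There is no multiplication of natural numbers, no rounding of reals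
and no root extraction, and all constants are natural or rational numbers. -/
inductive Instr where
  | nconst (i c : ℕ)
  | nadd (i j k : ℕ)
  | nsub (i j k : ℕ)
  | nload (i a j : ℕ)
  | nstore (a j i : ℕ)
  | rconst (i : ℕ) (q : ℚ)
  | radd (i j k : ℕ)
  | rsub (i j k : ℕ)
  | rmul (i j k : ℕ)
  | rdiv (i j k : ℕ)
  | rload (i a j : ℕ)
  | rstore (a j i : ℕ)

/-- Effect of an instruction. Here `nload`, `rload` read cell `nreg j` of array `a` into register
`i`, and `nstore`, `rstore` write register `i` into cell `nreg j` of array `a`; natural subtraction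
is truncated at `0`, and a division by zero gives `0`. -/
noncomputable def Instr.exec (σ : State) : Instr → State
  | .nconst i c => { σ with nreg := Function.update σ.nreg i c }
  | .nadd i j k => { σ with nreg := Function.update σ.nreg i (σ.nreg j + σ.nreg k) }
  | .nsub i j k => { σ with nreg := Function.update σ.nreg i (σ.nreg j - σ.nreg k) }
  | .nload i a j => { σ with nreg := Function.update σ.nreg i (σ.narr a (σ.nreg j)) }
  | .nstore a j i =>
      { σ with narr := Function.update σ.narr a
                 (Function.update (σ.narr a) (σ.nreg j) (σ.nreg i)) }
  | .rconst i q => { σ with rreg := Function.update σ.rreg i (q : ℝ) }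
  | .radd i j k => { σ with rreg := Function.update σ.rreg i (σ.rreg j + σ.rreg k) }
  | .rsub i j k => { σ with rreg := Function.update σ.rreg i (σ.rreg j - σ.rreg k) }
  | .rmul i j k => { σ with rreg := Function.update σ.rreg i (σ.rreg j * σ.rreg k) }
  | .rdiv i j k => { σ with rreg := Function.update σ.rreg i (σ.rreg j / σ.rreg k) }
  | .rload i a j => { σ with rreg := Function.update σ.rreg i (σ.rarr a (σ.nreg j)) }
  | .rstore a j i =>
      { σ with rarr := Function.update σ.rarr a
                 (Function.update (σ.rarr a) (σ.nreg j) (σ.rreg i)) }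

/-- Comparisons of two registers. -/
inductive Test where
  | nlt (i j : ℕ)
  | rlt (i j : ℕ)

def Test.Holds (σ : State) : Test → Prop
  | .nlt i j => σ.nreg i < σ.nreg j
  | .rlt i j => σ.rreg i < σ.rreg j

/-- Structured programs. -/
inductive Prog where
  | skip
  | instr (c : Instr)
  | seq (p q : Prog)
  | ite (b : Test) (p q : Prog)
  | while (b : Test) (p : Prog)

/-- `Run p σ t τ`: started in `σ`, the program `p` halts in `τ` after exactly `t` steps. Every
instruction and every evaluation of a comparison is one step. -/
inductive Run : Prog → State → ℕ → State → Prop where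
  | skip (σ : State) : Run .skip σ 1 σ
  | instr (c : Instr) (σ : State) : Run (.instr c) σ 1 (c.exec σ)
  | seq {p q : Prog} {σ τ υ : State} {t₁ t₂ : ℕ} :
      Run p σ t₁ τ → Run q τ t₂ υ → Run (.seq p q) σ (t₁ + t₂) υ
  | ite_true {b : Test} {p q : Prog} {σ τ : State} {t : ℕ} :
      b.Holds σ → Run p σ t τ → Run (.ite b p q) σ (1 + t) τ
  | ite_false {b : Test} {p q : Prog} {σ τ : State} {t : ℕ} :
      ¬ b.Holds σ → Run q σ t τ → Run (.ite b p q) σ (1 + t) τ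
  | while_true {b : Test} {p : Prog} {σ τ υ : State} {t₁ t₂ : ℕ} :
      b.Holds σ → Run p σ t₁ τ → Run (.while b p) τ t₂ υ → Run (.while b p) σ (1 + t₁ + t₂) υ
  | while_false {b : Test} {p : Prog} {σ : State} :
      ¬ b.Holds σ → Run (.while b p) σ 1 σ

/-- Input convention: natural register `0` holds `n`, real register `0` holds `α`, cell `i` of the
real array `k` holds the `k`-th coordinate of the `i`-th point, and all other memory is `0`. -/
noncomputable def input {d n : ℕ} (P : Fin n → EuclideanSpace ℝ (Fin d)) (α : ℝ) : State where
  nreg := Function.update 0 0 n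
  rreg := Function.update 0 0 α
  narr := 0
  rarr := fun k i => if h : k < d ∧ i < n then P ⟨i, h.2⟩ ⟨k, h.1⟩ else 0

/-- Output convention: natural register `1` holds the length `m` of a list of bought edges, and for
`e < m` the owner of the `e`-th edge is in cell `e` of the natural array `0` and its other endpoint
in cell `e` of the natural array `1`. -/
def State.Outputs {n : ℕ} (σ : State) (s : Fin n → Finset (Fin n)) : Prop :=
  (∀ e < σ.nreg 1, σ.narr 0 e < n ∧ σ.narr 1 e < n) ∧
    ∀ u v : Fin n, v ∈ s u ↔ ∃ e < σ.nreg 1, σ.narr 0 e = u ∧ σ.narr 1 e = v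

end RealRAM

/-! Since every path is at least as long as the segment between its ends, the cost of an agent `u`
is always at least `∑ v, edist (P u) (P v)`, whatever anyone buys. A network in which each agent
pays at most `β` times this sum is therefore a `β`-approximate equilibrium and within `β` of the
optimum at once. The construction achieves `β = d * (8 * K * (α / n) + 2)` with `K = (4 * d + 1) ^ d
+ 1`.

All lengths are measured in `ℓ¹`, which needs no square roots and loses at most a factor `d`. Let
`c` be an agent with the least sum of `ℓ¹` distances. Each `u` buys the edge to `c` and boundedly
many hops serving, direction by direction, the agents closer than four times the distance to `c`.
Near targets are reached by hops that make progress, far ones through `c`, so distances are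
stretched by at most 2 (`netDist_le_two_mul`). The purchases cost `u` at most `4 * K` times `α`
times her distance to `c`, and `n` times that distance is at most twice her distance sum
(`card_mul_l1Dist_hub_le`).

A packing argument (`card_le_of_separated`) bounds the greedy hops independently of `n`, so
linear-time scans give a quadratic algorithm. Finally `α / n` is compared with the stated powers of
`α`. -/

namespace NetworkCreation

variable {d n : ℕ}

/-! ### The `ℓ¹` metric and its comparison with the Euclidean one. -/

/-- The `ℓ¹` distance of two agents. -/
noncomputable def l1Dist (P : Fin n → EuclideanSpace ℝ (Fin d)) (u v : Fin n) : ℝ :=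
  ∑ k, |P u k - P v k|

section L1

variable (P : Fin n → EuclideanSpace ℝ (Fin d)) (u v w : Fin n)

theorem l1Dist_nonneg : 0 ≤ l1Dist P u v := Finset.sum_nonneg fun _ _ => abs_nonneg _

theorem l1Dist_self : l1Dist P u u = 0 := by simp [l1Dist]

theorem l1Dist_comm : l1Dist P u v = l1Dist P v u := by simp [l1Dist, abs_sub_comm]

theorem l1Dist_triangle : l1Dist P u w ≤ l1Dist P u v + l1Dist P v w := by
  rw [l1Dist, l1Dist, l1Dist, ← Finset.sum_add_distrib]
  exact Finset.sum_le_sum fun k _ => abs_sub_le _ _ _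

theorem dist_le_l1Dist : dist (P u) (P v) ≤ l1Dist P u v := by
  rw [EuclideanSpace.dist_eq]
  refine Real.sqrt_le_iff.2 ⟨l1Dist_nonneg P u v, ?_⟩
  simpa [l1Dist, Real.dist_eq] using
    Finset.sum_sq_le_sq_sum_of_nonneg (s := Finset.univ) (f := fun k => |P u k - P v k|)
      fun _ _ => abs_nonneg _

theorem l1Dist_le_dist : l1Dist P u v ≤ d * dist (P u) (P v) := by
  have h : ∀ k ∈ Finset.univ, |P u k - P v k| ≤ dist (P u) (P v) := fun k _ => by
    simpa [dist_eq_norm] using PiLp.norm_apply_le (P u - P v) k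
  simpa [l1Dist] using Finset.sum_le_card_nsmul _ _ _ h

theorem l1Dist_pos {P : Fin n → EuclideanSpace ℝ (Fin d)} (hP : Function.Injective P)
    {u v : Fin n} (h : u ≠ v) : 0 < l1Dist P u v :=
  (dist_pos.2 (hP.ne h)).trans_le (dist_le_l1Dist P u v)

theorem edist_le_l1Dist : edist (P u) (P v) ≤ ENNReal.ofReal (l1Dist P u v) := by
  rw [edist_dist]
  exact ENNReal.ofReal_le_ofReal (dist_le_l1Dist P u v)

end L1

/-! ### Progressing hops and the packing bound on directions. -/

/-- From `u`, a first hop to `v` makes progress towards `w`. -/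
def Covers (P : Fin n → EuclideanSpace ℝ (Fin d)) (u v w : Fin n) : Prop :=
  2 * l1Dist P v w + l1Dist P u v ≤ 2 * l1Dist P u w

/-- Agents whose directions from `u` are pairwise separated are few. -/
theorem card_le_of_separated (P : Fin n → EuclideanSpace ℝ (Fin d)) (u : Fin n)
    (T : Finset (Fin n)) (hpos : ∀ v ∈ T, 0 < l1Dist P u v)
    (hsep : ∀ v ∈ T, ∀ w ∈ T, v ≠ w → l1Dist P u v ≤ l1Dist P u w → ¬ Covers P u v w) :
    T.card ≤ (4 * d + 1) ^ d := by
  classical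
  have key : ∀ v ∈ T, ∀ k, |(P v k - P u k) / l1Dist P u v| ≤ 1 := by
    intro v hv k
    rw [abs_div, abs_of_pos (hpos v hv), div_le_one (hpos v hv), abs_sub_comm]
    exact Finset.single_le_sum (f := fun k => |P u k - P v k|) (fun _ _ => abs_nonneg _)
      (Finset.mem_univ k)
  -- Normalised directions lie in `[-1, 1]^d`; a grid of mesh `1 / (2 * d)` has `4 * d + 1` possible
  -- floors per coordinate. Two agents in one cell would violate separation, so `cell` is injective
  -- on `T`.
  let cell : Fin n → Fin d → ℤ := fun v k => ⌊2 * d * ((P v k - P u k) / l1Dist P u v)⌋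
  have hmaps : ∀ v ∈ T, cell v ∈
      Fintype.piFinset fun _ : Fin d => Finset.Icc (-(2 * d : ℤ)) (2 * d) := by
    intro v hv
    refine Fintype.mem_piFinset.2 fun k => Finset.mem_Icc.2 ?_
    have h := abs_le.1 (key v hv k)
    have hd : (0 : ℝ) ≤ 2 * d := by positivity
    constructor
    · refine Int.le_floor.2 ?_
      push_cast
      nlinarith
    · have : (cell v k : ℝ) ≤ 2 * d := (Int.floor_le _).trans (by nlinarith)
      exact_mod_cast this
  have hcov : ∀ v ∈ T, ∀ w ∈ T, cell v = cell w → l1Dist P u v ≤ l1Dist P u w →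
      Covers P u v w := by
    intro v hv w hw h hle
    have hv0 := hpos v hv
    have hw0 := hpos w hw
    -- Walk back from `w` along its own direction to the radius of `v`, then correct the direction.
    -- Summed over `k`, the first part is the difference of the radii and the second at most half
    -- the radius of `v`, which is `Covers`.
    have hk : ∀ k, |P v k - P w k| ≤ (l1Dist P u w - l1Dist P u v) *
        (|P u k - P w k| / l1Dist P u w) + l1Dist P u v * (1 / (2 * d)) := by
      intro k
      have hd : (0 : ℝ) < 2 * d := by
        have : 0 < d := k.pos
        positivity
      have h1 := Int.abs_sub_lt_one_of_floor_eq_floor (congrFun h k)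
      rw [← mul_sub, abs_mul, abs_of_pos hd, ← lt_div_iff₀' hd] at h1
      have e : P v k - P w k = -((l1Dist P u w - l1Dist P u v) *
            ((P w k - P u k) / l1Dist P u w)) + l1Dist P u v *
            ((P v k - P u k) / l1Dist P u v - (P w k - P u k) / l1Dist P u w) := by
        field_simp
        ring
      rw [e]
      refine (abs_add_le _ _).trans (add_le_add ?_ ?_)
      · rw [abs_neg, abs_mul, abs_of_nonneg (sub_nonneg.2 hle), abs_div, abs_of_pos hw0,
          abs_sub_comm]
      · rw [abs_mul, abs_of_pos hv0]
        exact mul_le_mul_of_nonneg_left h1.le hv0.le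
    have hs : l1Dist P v w ≤ _ := Finset.sum_le_sum fun k _ => hk k
    rw [Finset.sum_add_distrib, ← Finset.mul_sum, ← Finset.sum_div, Finset.sum_const,
      Finset.card_univ, Fintype.card_fin, nsmul_eq_mul] at hs
    have h1 : (∑ k, |P u k - P w k|) / l1Dist P u w = 1 := div_self hw0.ne'
    rw [h1] at hs
    have h2 : (d : ℝ) * (l1Dist P u v * (1 / (2 * d))) ≤ l1Dist P u v / 2 := by
      rcases Nat.eq_zero_or_pos d with rfl | hd
      · simp
        positivity
      · have : (d : ℝ) ≠ 0 := by positivity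
        field_simp
        simp
    rw [Covers]
    linarith
  have hinj : Set.InjOn cell T := by
    intro v hv w hw h
    by_contra hne
    rcases le_total (l1Dist P u v) (l1Dist P u w) with hle | hle
    · exact hsep v hv w hw hne hle (hcov v hv w hw h hle)
    · exact hsep w hw v hv (Ne.symm hne) hle (hcov w hw v hv h.symm hle)
  have hc := Finset.card_le_card_of_injOn cell hmaps hinj
  rw [Fintype.card_piFinset] at hc
  simp only [Int.card_Icc, Finset.prod_const, Finset.card_univ, Fintype.card_fin] at hc
  convert hc using 2
  omega

/-- A strategy of `u` that reaches the hub `c` and has a progressing hop towards each agent not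
much farther away than `c`, at a price comparable to that of the edge to `c`. -/
structure IsHubStrategy (P : Fin n → EuclideanSpace ℝ (Fin d)) (c u : Fin n) (K : ℕ)
    (S : Finset (Fin n)) : Prop where
  notMem : u ∉ S
  hub_mem : u ≠ c → c ∈ S
  le_hub : ∀ v ∈ S, l1Dist P u v ≤ 4 * l1Dist P u c
  card_le : S.card ≤ K
  exists_covers : ∀ w, w ≠ u → l1Dist P u w < 4 * l1Dist P u c → ∃ v ∈ S, Covers P u v w

/-! ### Stretch and cost of networks made of hub strategies. -/

section NetDist

variable (P : Fin n → EuclideanSpace ℝ (Fin d)) {G : SimpleGraph (Fin n)} {u v w : Fin n}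

theorem netDist_self : netDist P G u u = 0 :=
  le_antisymm (iInf_le_of_le SimpleGraph.Walk.nil (by simp [walkLength])) bot_le

theorem netDist_le_edist_add (h : G.Adj u v) :
    netDist P G u w ≤ edist (P u) (P v) + netDist P G v w := by
  unfold netDist
  rw [ENNReal.add_iInf]
  exact le_iInf fun p => iInf_le_of_le (SimpleGraph.Walk.cons h p) (by simp [walkLength])

theorem edist_le_walkLength (p : G.Walk u v) : edist (P u) (P v) ≤ walkLength P p := by
  induction p with
  | nil => simp [walkLength]
  | @cons a b e h p ih =>
    refine (edist_triangle _ (P b) _).trans ?_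
    exact (add_le_add_right ih _).trans_eq (by simp [walkLength])

theorem edist_le_netDist : edist (P u) (P v) ≤ netDist P G u v :=
  le_iInf fun p => edist_le_walkLength P p

end NetDist

section Hub

variable {P : Fin n → EuclideanSpace ℝ (Fin d)} {c : Fin n} {K : ℕ}
  {s : Fin n → Finset (Fin n)}

theorem network_adj_of_mem (hs : IsStrategyProfile s) {u v : Fin n} (h : v ∈ s u) :
    (network s).Adj u v := by
  refine (SimpleGraph.fromRel_adj _ _ _).2 ⟨?_, Or.inl h⟩
  rintro rfl
  exact hs _ h

theorem netDist_hub_le (hS : ∀ u, IsHubStrategy P c u K (s u)) (u : Fin n) :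
    netDist P (network s) u c ≤ ENNReal.ofReal (l1Dist P u c) ∧
      netDist P (network s) c u ≤ ENNReal.ofReal (l1Dist P u c) := by
  by_cases h : u = c
  · subst h
    simp [netDist_self]
  · have ha := network_adj_of_mem (fun u => (hS u).notMem) ((hS u).hub_mem h)
    constructor
    · refine (netDist_le_edist_add P ha).trans ?_
      rw [netDist_self, add_zero]
      exact edist_le_l1Dist P u c
    · refine (netDist_le_edist_add P ha.symm).trans ?_
      rw [netDist_self, add_zero, edist_comm]
      exact edist_le_l1Dist P u c

theorem netDist_trans_hub (hS : ∀ u, IsHubStrategy P c u K (s u)) (u w : Fin n) :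
    netDist P (network s) u w ≤ ENNReal.ofReal (l1Dist P u c + l1Dist P w c) := by
  rw [ENNReal.ofReal_add (l1Dist_nonneg _ _ _) (l1Dist_nonneg _ _ _)]
  by_cases h : u = c
  · subst h
    exact (netDist_hub_le hS w).2.trans le_add_self
  · have ha := network_adj_of_mem (fun u => (hS u).notMem) ((hS u).hub_mem h)
    exact (netDist_le_edist_add P ha).trans
      (add_le_add (edist_le_l1Dist P u c) (netDist_hub_le hS w).2)

/-- A covering hop pays for itself: its length plus twice the remaining distance is at most twice
the original distance, so induction on the distance applies. Targets beyond the range of the hops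
are so far that the detour through the hub is cheap. -/
theorem netDist_le_two_mul (hP : Function.Injective P)
    (hS : ∀ u, IsHubStrategy P c u K (s u)) (u w : Fin n) :
    netDist P (network s) u w ≤ ENNReal.ofReal (2 * l1Dist P u w) := by
  -- Real distances are not well ordered, but there are only finitely many pairs of agents.
  have hwf : WellFounded fun a b : Fin n × Fin n => l1Dist P a.1 a.2 < l1Dist P b.1 b.2 :=
    have : IsTrans (Fin n × Fin n) fun a b => l1Dist P a.1 a.2 < l1Dist P b.1 b.2 :=
      ⟨fun _ _ _ => lt_trans⟩
    have : Std.Irrefl fun a b : Fin n × Fin n => l1Dist P a.1 a.2 < l1Dist P b.1 b.2 :=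
      ⟨fun _ => lt_irrefl _⟩
    Finite.wellFounded_of_trans_of_irrefl _
  have main : ∀ a : Fin n × Fin n,
      netDist P (network s) a.1 a.2 ≤ ENNReal.ofReal (2 * l1Dist P a.1 a.2) := by
    intro a
    induction a using hwf.induction with
    | _ a ih =>
      obtain ⟨u, w⟩ := a
      dsimp only at ih ⊢
      by_cases huw : w = u
      · subst huw
        simp [netDist_self]
      by_cases hfar : l1Dist P u w < 4 * l1Dist P u c
      · obtain ⟨v, hv, hcov⟩ := (hS u).exists_covers w huw hfar
        have huv : u ≠ v := by
          rintro rfl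
          exact (hS _).notMem hv
        have h0 := l1Dist_pos hP huv
        rw [Covers] at hcov
        have hlt : l1Dist P v w < l1Dist P u w := by linarith
        refine (netDist_le_edist_add P
          (network_adj_of_mem (fun u => (hS u).notMem) hv)).trans ?_
        refine (add_le_add (edist_le_l1Dist P u v) (ih (v, w) hlt)).trans ?_
        rw [← ENNReal.ofReal_add h0.le (by have := l1Dist_nonneg P v w; positivity)]
        exact ENNReal.ofReal_le_ofReal (by dsimp only; linarith)
      -- The route through `c` has length at most `2 * l1Dist P u c + l1Dist P u w`, hence at most
      -- `3 / 2` times the direct distance.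
      · refine (netDist_trans_hub hS u w).trans (ENNReal.ofReal_le_ofReal ?_)
        have h1 := l1Dist_triangle P w u c
        have h2 := l1Dist_comm P w u
        have h3 := l1Dist_nonneg P u c
        linarith
  exact main (u, w)

/-- Sum the triangle inequality through `v` over all `v`; minimality of `c` bounds its distance sum
by that of `u`. -/
theorem card_mul_l1Dist_hub_le
    (hc : ∀ u, ∑ v, l1Dist P c v ≤ ∑ v, l1Dist P u v) (u : Fin n) :
    n * l1Dist P u c ≤ 2 * ∑ v, l1Dist P u v := by
  have h : ∑ _v : Fin n, l1Dist P u c ≤ ∑ v, (l1Dist P u v + l1Dist P c v) :=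
    Finset.sum_le_sum fun v _ => by
      rw [l1Dist_comm P c v]
      exact l1Dist_triangle P u v c
  rw [Finset.sum_add_distrib, Finset.sum_const, Finset.card_univ, Fintype.card_fin,
    nsmul_eq_mul] at h
  linarith [hc u]

theorem cost_le (hP : Function.Injective P) (hS : ∀ u, IsHubStrategy P c u K (s u))
    (hc : ∀ u, ∑ v, l1Dist P c v ≤ ∑ v, l1Dist P u v) {α : ℝ} (hα : 0 < α) (hn : 1 ≤ n)
    (u : Fin n) :
    cost P α s u ≤ ENNReal.ofReal (d * (8 * K * (α / n) + 2)) * ∑ v, edist (P u) (P v) := by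
  have hn0 : (0 : ℝ) < n := by exact_mod_cast hn
  have hD : 0 ≤ ∑ v, l1Dist P u v := Finset.sum_nonneg fun v _ => l1Dist_nonneg P u v
  have h1 : ∑ v ∈ s u, edist (P u) (P v) ≤ ENNReal.ofReal (K * (4 * l1Dist P u c)) := by
    refine (Finset.sum_le_sum fun v _ => edist_le_l1Dist P u v).trans ?_
    rw [← ENNReal.ofReal_sum_of_nonneg fun v _ => l1Dist_nonneg P u v]
    refine ENNReal.ofReal_le_ofReal ?_
    refine (Finset.sum_le_card_nsmul _ _ _ (hS u).le_hub).trans ?_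
    rw [nsmul_eq_mul]
    have := l1Dist_nonneg P u c
    have h : ((s u).card : ℝ) ≤ K := by exact_mod_cast (hS u).card_le
    gcongr
  have h2 : ∑ v, netDist P (network s) u v ≤ ENNReal.ofReal (2 * ∑ v, l1Dist P u v) := by
    rw [Finset.mul_sum, ENNReal.ofReal_sum_of_nonneg fun v _ =>
      mul_nonneg zero_le_two (l1Dist_nonneg P u v)]
    exact Finset.sum_le_sum fun v _ => netDist_le_two_mul hP hS u v
  have h3 : ENNReal.ofReal (∑ v, l1Dist P u v) ≤ ENNReal.ofReal d * ∑ v, edist (P u) (P v) := by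
    simp only [edist_dist]
    rw [← ENNReal.ofReal_sum_of_nonneg fun v _ => dist_nonneg,
      ← ENNReal.ofReal_mul (by positivity), Finset.mul_sum]
    exact ENNReal.ofReal_le_ofReal (Finset.sum_le_sum fun v _ => l1Dist_le_dist P u v)
  have hh : l1Dist P u c ≤ 2 * (∑ v, l1Dist P u v) / n := by
    rw [le_div_iff₀ hn0, mul_comm]
    exact card_mul_l1Dist_hub_le hc u
  have h4 : α * (K * (4 * l1Dist P u c)) + 2 * ∑ v, l1Dist P u v ≤
      (8 * K * (α / n) + 2) * ∑ v, l1Dist P u v := by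
    have : α * (K * (4 * l1Dist P u c)) ≤ α * (K * (4 * (2 * (∑ v, l1Dist P u v) / n))) := by
      gcongr
    calc _ ≤ _ := add_le_add_left this _
      _ = _ := by ring
  have hc0 := l1Dist_nonneg P u c
  calc cost P α s u ≤ ENNReal.ofReal α * ENNReal.ofReal (K * (4 * l1Dist P u c)) +
        ENNReal.ofReal (2 * ∑ v, l1Dist P u v) := add_le_add (mul_le_mul_right h1 _) h2
    _ = ENNReal.ofReal (α * (K * (4 * l1Dist P u c)) + 2 * ∑ v, l1Dist P u v) := by
      rw [← ENNReal.ofReal_mul hα.le, ← ENNReal.ofReal_add (by positivity) (by positivity)]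
    _ ≤ ENNReal.ofReal ((8 * K * (α / n) + 2) * ∑ v, l1Dist P u v) :=
      ENNReal.ofReal_le_ofReal h4
    _ = ENNReal.ofReal (8 * K * (α / n) + 2) * ENNReal.ofReal (∑ v, l1Dist P u v) :=
      ENNReal.ofReal_mul (by positivity)
    _ ≤ ENNReal.ofReal (8 * K * (α / n) + 2) *
        (ENNReal.ofReal d * ∑ v, edist (P u) (P v)) := mul_le_mul_right h3 _
    _ = _ := by
      rw [← mul_assoc, ← ENNReal.ofReal_mul (by positivity), mul_comm (d : ℝ)]

/-- This lower bound is independent of the profile, so it serves both for deviations and for the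
optimum. -/
theorem sum_edist_le_cost (P : Fin n → EuclideanSpace ℝ (Fin d)) (α : ℝ)
    (s : Fin n → Finset (Fin n)) (u : Fin n) : ∑ v, edist (P u) (P v) ≤ cost P α s u :=
  (Finset.sum_le_sum fun _ _ => edist_le_netDist P).trans le_add_self

theorem exists_isSocialOptimum (P : Fin n → EuclideanSpace ℝ (Fin d)) (α : ℝ) :
    ∃ s, IsSocialOptimum P α s := by
  obtain ⟨s, hs, hmin⟩ := Set.exists_min_image
    {s : Fin n → Finset (Fin n) | IsStrategyProfile s} (socialCost P α) (Set.toFinite _)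
    ⟨fun _ => ∅, fun _ => by simp⟩
  exact ⟨s, hs, hmin⟩

theorem isBetaGammaNE_of_isHubStrategy (hP : Function.Injective P)
    (hS : ∀ u, IsHubStrategy P c u K (s u))
    (hc : ∀ u, ∑ v, l1Dist P c v ≤ ∑ v, l1Dist P u v) {α : ℝ} (hα : 0 < α) (hn : 1 ≤ n) :
    IsBetaGammaNE P α (d * (8 * K * (α / n) + 2)) (d * (8 * K * (α / n) + 2)) s := by
  refine ⟨⟨fun u => (hS u).notMem, fun u T _ => (cost_le hP hS hc hα hn u).trans
    (mul_le_mul_right (sum_edist_le_cost P α _ u) _)⟩, ?_⟩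
  obtain ⟨o, ho⟩ := exists_isSocialOptimum P α
  refine ⟨o, ho, ?_⟩
  rw [socialCost, socialCost, Finset.mul_sum]
  exact Finset.sum_le_sum fun u _ => (cost_le hP hS hc hα hn u).trans
    (mul_le_mul_right (sum_edist_le_cost P α _ u) _)

end Hub

/-! ### Greedy choice of the hops. -/

/-- Agents that `u` still has to be given a hop to, after the picks `T`. -/
def IsLive (P : Fin n → EuclideanSpace ℝ (Fin d)) (c u : Fin n) (T : Finset (Fin n))
    (w : Fin n) : Prop :=
  0 < l1Dist P u w ∧ l1Dist P u w < 4 * l1Dist P u c ∧ ∀ v ∈ T, ¬ Covers P u v w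

/-- `T` arises by repeatedly picking a live agent nearest to `u`. -/
structure IsGreedy (P : Fin n → EuclideanSpace ℝ (Fin d)) (c u : Fin n)
    (T : Finset (Fin n)) : Prop where
  pos : ∀ v ∈ T, 0 < l1Dist P u v
  lt_hub : ∀ v ∈ T, l1Dist P u v < 4 * l1Dist P u c
  le_live : ∀ v ∈ T, ∀ w, IsLive P c u T w → l1Dist P u v ≤ l1Dist P u w
  separated : ∀ v ∈ T, ∀ w ∈ T, v ≠ w → l1Dist P u v ≤ l1Dist P u w → ¬ Covers P u v w

section Greedy

variable {P : Fin n → EuclideanSpace ℝ (Fin d)} {c u v w : Fin n} {T : Finset (Fin n)}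

theorem covers_self (P : Fin n → EuclideanSpace ℝ (Fin d)) (u v : Fin n) : Covers P u v v := by
  have := l1Dist_nonneg P u v
  rw [Covers, l1Dist_self]
  linarith

theorem isLive_insert : IsLive P c u (insert v T) w ↔ IsLive P c u T w ∧ ¬ Covers P u v w := by
  simp only [IsLive, Finset.forall_mem_insert]
  tauto

theorem IsLive.notMem (h : IsLive P c u T v) : v ∉ T := fun hv => h.2.2 v hv (covers_self P u v)

theorem isGreedy_empty : IsGreedy P c u ∅ := by
  constructor <;> simp

theorem covers_symm_of_eq (h : l1Dist P u v = l1Dist P u w) (hc : Covers P u v w) :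
    Covers P u w v := by
  rw [Covers, l1Dist_comm P w v]
  rw [Covers] at hc
  linarith

/-- An earlier pick does not cover `v` because `v` is live. Conversely, earlier picks are no farther
than `v`, so `v` could violate separation against one only in a tie, where covering is symmetric. -/
theorem IsGreedy.insert (hT : IsGreedy P c u T) (hv : IsLive P c u T v)
    (hmin : ∀ w, IsLive P c u T w → l1Dist P u v ≤ l1Dist P u w) :
    IsGreedy P c u (insert v T) where
  pos := Finset.forall_mem_insert _ _ _ |>.2 ⟨hv.1, hT.pos⟩
  lt_hub := Finset.forall_mem_insert _ _ _ |>.2 ⟨hv.2.1, hT.lt_hub⟩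
  le_live := Finset.forall_mem_insert _ _ _ |>.2
    ⟨fun w hw => hmin w (isLive_insert.1 hw).1,
      fun x hx w hw => hT.le_live x hx w (isLive_insert.1 hw).1⟩
  separated := by
    intro x hx y hy hne hle
    rcases Finset.mem_insert.1 hx with rfl | hx' <;> rcases Finset.mem_insert.1 hy with rfl | hy'
    · exact absurd rfl hne
    · intro hcov
      have he := le_antisymm hle (hT.le_live y hy' x hv)
      exact hv.2.2 y hy' (covers_symm_of_eq he hcov)
    · exact hv.2.2 x hx'
    · exact hT.separated x hx' y hy' hne hle

theorem IsGreedy.card_le (hT : IsGreedy P c u T) : T.card ≤ (4 * d + 1) ^ d :=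
  card_le_of_separated P u T hT.pos hT.separated

/-- A greedy set with the maximal number of picks leaves nothing live. -/
theorem IsGreedy.not_isLive (hT : IsGreedy P c u T) (hcard : T.card = (4 * d + 1) ^ d) (w : Fin n) :
    ¬ IsLive P c u T w := by
  classical
  intro hw
  obtain ⟨v, hv, hmin⟩ := Finset.exists_min_image
    (Finset.univ.filter fun w => IsLive P c u T w) (l1Dist P u) ⟨w, by simpa using hw⟩
  simp only [Finset.mem_filter, Finset.mem_univ, true_and] at hv hmin
  -- One more pick would exceed the packing bound.
  have := (hT.insert hv hmin).card_le
  rw [Finset.card_insert_of_notMem hv.notMem] at this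
  omega

theorem IsGreedy.isHubStrategy (hP : Function.Injective P) (hT : IsGreedy P c u T)
    (hlive : ∀ w, ¬ IsLive P c u T w) :
    IsHubStrategy P c u ((4 * d + 1) ^ d + 1) ((if u = c then ∅ else {c}) ∪ T) where
  notMem := by
    have h : u ∉ T := fun h => by simpa [l1Dist_self] using hT.pos u h
    split_ifs with huc
    · simpa using h
    · simp [h, huc]
  hub_mem h := by simp [h]
  le_hub v hv := by
    rcases Finset.mem_union.1 hv with h | h
    · split_ifs at h
      · simp at h
      · rw [Finset.mem_singleton.1 h]
        linarith [l1Dist_nonneg P u c]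
    · exact (hT.lt_hub v h).le
  card_le := by
    refine (Finset.card_union_le _ _).trans ?_
    have := hT.card_le
    split_ifs <;> simp <;> omega
  exists_covers w hw hlt := by
    by_contra! hno
    exact hlive w ⟨l1Dist_pos hP hw.symm, hlt, fun v hv => hno v (Finset.mem_union_right _ hv)⟩

end Greedy

end NetworkCreation

/-! ### Time-bounded Hoare rules for the machine. -/

namespace RealRAM

open NetworkCreation

/-- Started in `σ`, the program `p` halts within `T` steps in a state satisfying `Q`. -/
def Exec (p : Prog) (σ : State) (T : ℕ) (Q : State → Prop) : Prop :=
  ∃ t τ, t ≤ T ∧ Run p σ t τ ∧ Q τ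

theorem Exec.mono {p : Prog} {σ : State} {T T' : ℕ} {Q Q' : State → Prop}
    (h : Exec p σ T Q) (hT : T ≤ T') (hQ : ∀ τ, Q τ → Q' τ) : Exec p σ T' Q' := by
  obtain ⟨t, τ, ht, hr, hq⟩ := h
  exact ⟨t, τ, ht.trans hT, hr, hQ τ hq⟩

theorem Exec.skip {σ : State} {T : ℕ} {Q : State → Prop} (h : Q σ) (hT : 1 ≤ T := by omega) :
    Exec .skip σ T Q :=
  ⟨1, σ, hT, .skip σ, h⟩

theorem Exec.instr {c : Instr} {σ : State} {Q : State → Prop} (h : Q (c.exec σ)) :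
    Exec (.instr c) σ 1 Q :=
  ⟨1, _, le_rfl, .instr c σ, h⟩

theorem Exec.seq {p q : Prog} {σ : State} {T₁ T₂ : ℕ} {Q : State → Prop}
    (h : Exec p σ T₁ fun τ => Exec q τ T₂ Q) : Exec (.seq p q) σ (T₁ + T₂) Q := by
  obtain ⟨t₁, τ, h₁, hr₁, t₂, υ, h₂, hr₂, hq⟩ := h
  exact ⟨t₁ + t₂, υ, by omega, .seq hr₁ hr₂, hq⟩

theorem Exec.ite {b : Test} {p q : Prog} {σ : State} {T : ℕ} {Q : State → Prop}
    (hp : b.Holds σ → Exec p σ T Q) (hq : ¬ b.Holds σ → Exec q σ T Q) :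
    Exec (.ite b p q) σ (1 + T) Q := by
  by_cases hb : b.Holds σ
  · obtain ⟨t, τ, ht, hr, h⟩ := hp hb
    exact ⟨1 + t, τ, by omega, .ite_true hb hr, h⟩
  · obtain ⟨t, τ, ht, hr, h⟩ := hq hb
    exact ⟨1 + t, τ, by omega, .ite_false hb hr, h⟩

/-- `c` followed by `p`. -/
abbrev Instr.andThen (c : Instr) (p : Prog) : Prog := .seq (.instr c) p

theorem Exec.andThen {c : Instr} {p : Prog} {σ : State} {T : ℕ} {Q : State → Prop}
    (h : Exec p (c.exec σ) T Q) : Exec (c.andThen p) σ (1 + T) Q :=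
  Exec.seq (Exec.instr h)

/-- Run `p` with register `i` counting from `0` up to the value of register `0`; register `2` is
expected to hold `1`. -/
def Prog.for (i : ℕ) (p : Prog) : Prog :=
  (Instr.nconst i 0).andThen (.while (.nlt i 0) (.seq p (.instr (.nadd i i 2))))

/-- Each round adds the test and the increment to `T`; the final 2 is the initialisation and the
failing test. The invariant is restored only after the increment. -/
theorem Exec.for {n i T : ℕ} {p : Prog} {σ : State} {Q : State → Prop} (I : ℕ → State → Prop)
    (hreg : ∀ k τ, I k τ → τ.nreg i = k ∧ τ.nreg 0 = n)
    (h0 : I 0 ((Instr.nconst i 0).exec σ))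
    (hstep : ∀ k τ, k < n → I k τ →
      Exec p τ T fun υ => I (k + 1) ((Instr.nadd i i 2).exec υ))
    (hend : ∀ τ, I n τ → Q τ) : Exec (.for i p) σ (n * (T + 2) + 2) Q := by
  have main : ∀ m k τ, k + m = n → I k τ →
      Exec (.while (.nlt i 0) (.seq p (.instr (.nadd i i 2)))) τ (m * (T + 2) + 1) Q := by
    intro m
    induction m with
    | zero =>
      intro k τ hk hI
      obtain ⟨hi, hn⟩ := hreg k τ hI
      refine ⟨1, τ, by omega, .while_false ?_, hend τ ?_⟩
      · simp only [Test.Holds]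
        omega
      · rwa [← hk]
    | succ m ih =>
      intro k τ hk hI
      obtain ⟨hi, hn⟩ := hreg k τ hI
      obtain ⟨t₁, υ, ht₁, hr₁, h₁⟩ := hstep k τ (by omega) hI
      obtain ⟨t₂, ω, ht₂, hr₂, h₂⟩ := ih (k + 1) _ (by omega) h₁
      refine ⟨1 + (t₁ + 1) + t₂, ω, ?_, .while_true ?_ (.seq hr₁ (.instr _ _)) hr₂, h₂⟩
      · rw [Nat.succ_mul]
        omega
      · simp only [Test.Holds]
        omega
  exact (Exec.andThen (main n 0 _ (by omega) h0)).mono (by omega) fun _ h => h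

/-- `p` run `k` times. -/
def Prog.repeat (p : Prog) : ℕ → Prog
  | 0 => .skip
  | k + 1 => .seq (Prog.repeat p k) p

theorem Exec.repeat {T : ℕ} {p : Prog} {σ : State} (I : ℕ → State → Prop) (h0 : I 0 σ)
    (hstep : ∀ k τ, I k τ → Exec p τ T (I (k + 1))) (k : ℕ) :
    Exec (p.repeat k) σ (k * T + 1) (I k) := by
  induction k with
  | zero => exact Exec.skip h0
  | succ k ih =>
    exact (Exec.seq (ih.mono le_rfl fun τ h => hstep k τ h)).mono
      (by rw [Nat.succ_mul]; omega) fun _ h => h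

/-! ### Computing distances and the hub. -/

/-- Real register `1` receives the `ℓ¹` distance of the points number `nreg a` and `nreg b`,
restricted to the first `k` coordinates. -/
def distProg (a b : ℕ) : ℕ → Prog
  | 0 => .instr (.rconst 1 0)
  | k + 1 => .seq (distProg a b k) <| (Instr.rload 4 k a).andThen <| (Instr.rload 5 k b).andThen <|
      (Instr.rsub 4 4 5).andThen <| .seq (.ite (.rlt 4 7) (.instr (.rsub 4 7 4)) .skip) <|
      .instr (.radd 1 1 4)

theorem exec_distProg_aux {a b : ℕ} {σ : State} (h7 : σ.rreg 7 = 0) (k : ℕ) :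
    Exec (distProg a b k) σ (6 * k + 1) fun τ => ∃ ρ : ℕ → ℝ, τ = { σ with rreg := ρ } ∧
      ρ 1 = ∑ j ∈ Finset.range k, |σ.rarr j (σ.nreg a) - σ.rarr j (σ.nreg b)| ∧
      ∀ i, i ≠ 1 → i ≠ 4 → i ≠ 5 → ρ i = σ.rreg i := by
  induction k with
  | zero =>
    refine Exec.instr ⟨_, rfl, by simp, fun i h1 h4 h5 => by simp [h1]⟩
  | succ k ih =>
    refine (Exec.seq (ih.mono le_rfl ?_)).mono (T := 6 * k + 1 + 6) (by omega) fun _ h => h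
    rintro _ ⟨ρ, rfl, h1, hρ⟩
    have hρ7 : ρ 7 = 0 := by rw [hρ 7 (by decide) (by decide) (by decide), h7]
    refine Exec.andThen (T := 5) <| Exec.andThen (T := 4) <| Exec.andThen (T := 3) <|
      Exec.seq (T₁ := 2) (T₂ := 1) <| Exec.ite (T := 1) (fun hb => Exec.instr <| Exec.instr ?_)
        fun hb => Exec.skip <| Exec.instr ?_
    all_goals
      simp [Instr.exec, Test.Holds, hρ7] at hb
      refine ⟨_, rfl, ?_, fun i hi1 hi4 hi5 => ?_⟩
      · simp [Instr.exec, Finset.sum_range_succ, h1, hρ7]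
        first
          | rw [abs_of_neg (sub_neg.2 hb)]; ring
          | rw [abs_of_nonneg (sub_nonneg.2 hb)]
      · simp [Instr.exec, hi1, hi4, hi5, hρ]

variable {d n : ℕ} {P : Fin n → EuclideanSpace ℝ (Fin d)} {σ : State}

/-- The registers and arrays that stay fixed during the computation. -/
structure IsEnv (P : Fin n → EuclideanSpace ℝ (Fin d)) (σ : State) : Prop where
  size : σ.nreg 0 = n
  one : σ.nreg 2 = 1
  nzero : σ.nreg 9 = 0
  rzero : σ.rreg 7 = 0
  points : σ.rarr = (input P 0).rarr

/-- Running time of `distProg`. -/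
def distTime (d : ℕ) : ℕ := 6 * d + 1

/-- Only real registers change, so in the resulting state all other memory agrees definitionally
with `σ`; this is what lets callers discharge most frame conditions by `rfl`. -/
theorem exec_distProg (hσ : IsEnv P σ) {a b : ℕ} {u v : Fin n} (ha : σ.nreg a = u)
    (hb : σ.nreg b = v) {Q : State → Prop}
    (hQ : ∀ ρ : ℕ → ℝ, ρ 1 = l1Dist P u v →
      (∀ i, i ≠ 1 → i ≠ 4 → i ≠ 5 → ρ i = σ.rreg i) → Q { σ with rreg := ρ }) :
    Exec (distProg a b d) σ (distTime d) Q := by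
  refine (exec_distProg_aux hσ.rzero d).mono le_rfl ?_
  rintro _ ⟨ρ, rfl, h1, hρ⟩
  refine hQ ρ ?_ hρ
  rw [h1, ha, hb, hσ.points, l1Dist, Finset.sum_range]
  simp [input]

theorem IsEnv.congr (h : IsEnv P σ) {τ : State} (h0 : τ.nreg 0 = σ.nreg 0)
    (h2 : τ.nreg 2 = σ.nreg 2) (h9 : τ.nreg 9 = σ.nreg 9) (h7 : τ.rreg 7 = σ.rreg 7)
    (ha : τ.rarr = σ.rarr) : IsEnv P τ :=
  ⟨h0.trans h.size, h2.trans h.one, h9.trans h.nzero, h7.trans h.rzero, ha.trans h.points⟩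

/-- Real register `2` receives the sum of the `ℓ¹` distances from the point number `nreg 3`. -/
def sumProg (d : ℕ) : Prog :=
  (Instr.rconst 2 0).andThen <| .for 4 <| .seq (distProg 3 4 d) <| .instr <| .radd 2 2 1

theorem sum_filter_val_lt_succ (f : Fin n → ℝ) (k : Fin n) :
    ∑ v with v.val < k.val + 1, f v = ∑ v with v.val < k.val, f v + f k := by
  have : (Finset.univ.filter fun v : Fin n => v.val < k.val + 1) =
      insert k (Finset.univ.filter fun v : Fin n => v.val < k.val) := by
    ext v
    simp only [Finset.mem_filter, Finset.mem_univ, true_and, Finset.mem_insert, Fin.ext_iff]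
    omega
  rw [this, Finset.sum_insert (by simp), add_comm]

theorem exec_sumProg (hσ : IsEnv P σ) {u : Fin n} (hu : σ.nreg 3 = u) :
    Exec (sumProg d) σ (1 + (n * (distTime d + 1 + 2) + 2)) fun τ => IsEnv P τ ∧ τ.nreg 3 = u ∧
      τ.nreg 5 = σ.nreg 5 ∧ τ.rreg 3 = σ.rreg 3 ∧ τ.rreg 2 = ∑ v, l1Dist P u v := by
  refine Exec.andThen <| Exec.for (fun k τ => IsEnv P τ ∧ τ.nreg 4 = k ∧ τ.nreg 3 = u ∧
    τ.nreg 5 = σ.nreg 5 ∧ τ.rreg 3 = σ.rreg 3 ∧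
    τ.rreg 2 = ∑ v : Fin n with v.val < k, l1Dist P u v) ?_ ?_ ?_ ?_
  · exact fun k τ h => ⟨h.2.1, h.1.size⟩
  · exact ⟨hσ.congr rfl rfl rfl rfl rfl, by simp [Instr.exec, hu]⟩
  · rintro k τ hk ⟨hτ, h4, h3, h5, hr3, hr2⟩
    refine Exec.seq <| exec_distProg hτ h3 (v := ⟨k, hk⟩) h4 fun ρ h1 hρ => Exec.instr ?_
    refine ⟨hτ.congr rfl rfl rfl ?_ rfl, ?_, h3, h5, ?_, ?_⟩
    · simp [Instr.exec, hρ]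
    · simp [Instr.exec, h4, hτ.one]
    · simp [Instr.exec, hρ, hr3]
    · simp only [Instr.exec, Function.update_self, h1, hρ 2 (by decide) (by decide) (by decide),
        hr2]
      exact (sum_filter_val_lt_succ (l1Dist P u) ⟨k, hk⟩).symm
  · rintro τ ⟨hτ, -, h3, h5, hr3, hr2⟩
    refine ⟨hτ, h3, h5, hr3, ?_⟩
    rw [hr2]
    congr 1
    simp

/-- Register `5` receives the number of the point with the least sum of `ℓ¹` distances. -/
def hubProg (d : ℕ) : Prog :=
  .for 3 <| .seq (sumProg d) <|
    -- Adding the zero kept in real register `7` or natural register `9` copies a register. The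
    -- second test detects index 0, whose point is accepted whatever real register `3` contains.
    .ite (.rlt 2 3) ((Instr.radd 3 2 7).andThen (.instr (.nadd 5 3 9))) <|
    .ite (.nlt 3 2) ((Instr.radd 3 2 7).andThen (.instr (.nadd 5 3 9))) <|
    .skip

theorem exec_hubProg (hσ : IsEnv P σ) (hn : 1 ≤ n) :
    Exec (hubProg d) σ
      (n * (1 + (n * (distTime d + 1 + 2) + 2) + (1 + (1 + (1 + 1))) + 2) + 2) fun τ =>
      IsEnv P τ ∧ ∃ c : Fin n, τ.nreg 5 = c ∧ ∀ u, ∑ v, l1Dist P c v ≤ ∑ v, l1Dist P u v := by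
  refine Exec.for (fun k τ => IsEnv P τ ∧ τ.nreg 3 = k ∧ (0 < k → ∃ c : Fin n, τ.nreg 5 = c ∧
    τ.rreg 3 = ∑ v, l1Dist P c v ∧ ∀ u : Fin n, u.val < k →
      ∑ v, l1Dist P c v ≤ ∑ v, l1Dist P u v)) ?_ ?_ ?_ ?_
  · exact fun k τ h => ⟨h.2.1, h.1.size⟩
  · exact ⟨hσ.congr rfl rfl rfl rfl rfl, by simp [Instr.exec]⟩
  · rintro k τ hk ⟨hτ, h3, hc⟩
    refine Exec.seq <| (exec_sumProg hτ (u := ⟨k, hk⟩) h3).mono le_rfl ?_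
    rintro υ ⟨hυ, hυ3, hυ5, hυr3, hυr2⟩
    have take : (0 < k → υ.rreg 2 < υ.rreg 3) →
        Exec ((Instr.radd 3 2 7).andThen (.instr (.nadd 5 3 9))) υ (1 + 1) fun υ =>
          IsEnv P ((Instr.nadd 3 3 2).exec υ) ∧ ((Instr.nadd 3 3 2).exec υ).nreg 3 = k + 1 ∧
          (0 < k + 1 → ∃ c : Fin n, ((Instr.nadd 3 3 2).exec υ).nreg 5 = c ∧
          ((Instr.nadd 3 3 2).exec υ).rreg 3 = ∑ v, l1Dist P c v ∧
          ∀ u : Fin n, u.val < k + 1 → ∑ v, l1Dist P c v ≤ ∑ v, l1Dist P u v) := by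
      refine fun hlt => Exec.andThen <| Exec.instr
        ⟨hυ.congr rfl rfl rfl rfl rfl, ?_, fun _ => ⟨⟨k, hk⟩, ?_, ?_, ?_⟩⟩
      · simp [Instr.exec, hυ3, hυ.one]
      · simp [Instr.exec, hυ3, hυ.nzero]
      · simp [Instr.exec, hυr2, hυ.rzero]
      · intro u hu
        rcases Nat.lt_succ_iff_lt_or_eq.1 hu with h | h
        · obtain ⟨c, -, hc3, hmin⟩ := hc (by omega)
          have := hlt (by omega)
          rw [hυr2, hυr3, hc3] at this
          exact this.le.trans (hmin u h)
        · have : u = ⟨k, hk⟩ := Fin.ext h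
          rw [this]
    refine Exec.ite (b := .rlt 2 3) (fun hb => (take fun _ => hb).mono (by omega) fun _ h => h) fun hb =>
      Exec.ite (fun hb' => take fun h => ?_) fun hb' => Exec.skip ?_
    · simp only [Test.Holds, hυ3, hυ.one] at hb'
      omega
    · simp only [Test.Holds, hυ3, hυ.one, not_lt, hυr2] at hb hb'
      obtain ⟨c, hc5, hc3, hmin⟩ := hc (by omega)
      refine ⟨hυ.congr rfl rfl rfl rfl rfl, ?_, fun _ => ⟨c, ?_, ?_, ?_⟩⟩
      · simp [Instr.exec, hυ3, hυ.one]
      · simp [Instr.exec, hυ5, hc5]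
      · simp [Instr.exec, hυr3, hc3]
      · intro u hu
        rcases Nat.lt_succ_iff_lt_or_eq.1 hu with h | h
        · exact hmin u h
        · have : u = ⟨k, hk⟩ := Fin.ext h
          rwa [this, ← hc3, ← hυr3]
  · rintro τ ⟨hτ, -, hc⟩
    obtain ⟨c, h5, -, hmin⟩ := hc hn
    exact ⟨hτ, c, h5, fun u => hmin u u.2⟩

/-! ### Computing the strategy of one agent. -/

theorem State.Outputs.congr {τ : State} {s : Fin n → Finset (Fin n)} (h : σ.Outputs s)
    (h1 : τ.nreg 1 = σ.nreg 1) (ha : τ.narr 0 = σ.narr 0) (hb : τ.narr 1 = σ.narr 1) :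
    τ.Outputs s := by
  unfold State.Outputs
  rw [h1, ha, hb]
  exact h

/-- Append the edge from `nreg 3` to `nreg j` to the output. -/
def appendProg (j : ℕ) : Prog :=
  (Instr.nstore 0 1 3).andThen <| (Instr.nstore 1 1 j).andThen <| .instr (.nadd 1 1 2)

theorem exec_appendProg {j : ℕ} {s : Fin n → Finset (Fin n)} {u v : Fin n} (hs : σ.Outputs s)
    (h2 : σ.nreg 2 = 1) (hu : σ.nreg 3 = u) (hv : σ.nreg j = v) {Q : State → Prop}
    (hQ : ∀ a, a 2 = σ.narr 2 →
      State.Outputs { σ with nreg := Function.update σ.nreg 1 (σ.nreg 1 + 1), narr := a }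
        (Function.update s u (insert v (s u))) →
      Q { σ with nreg := Function.update σ.nreg 1 (σ.nreg 1 + 1), narr := a }) :
    Exec (appendProg j) σ (1 + (1 + 1)) Q := by
  refine Exec.andThen <| Exec.andThen <| Exec.instr ?_
  simp only [Instr.exec, h2]
  obtain ⟨a, ha⟩ : ∃ a, a = Function.update (Function.update σ.narr 0
      (Function.update (σ.narr 0) (σ.nreg 1) (σ.nreg 3))) 1
      (Function.update (Function.update σ.narr 0
        (Function.update (σ.narr 0) (σ.nreg 1) (σ.nreg 3)) 1) (σ.nreg 1) (σ.nreg j)) := ⟨_, rfl⟩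
  have h0 : a 0 = Function.update (σ.narr 0) (σ.nreg 1) u := by simp [ha, hu]
  have h1 : a 1 = Function.update (σ.narr 1) (σ.nreg 1) v := by simp [ha, hv]
  rw [← ha]
  refine hQ a (by simp [ha]) ?_
  obtain ⟨hlt, hmem⟩ := hs
  simp only [State.Outputs, Function.update_self, h0, h1]
  refine ⟨fun e he => ?_, fun x y => ?_⟩
  · by_cases h : e = σ.nreg 1
    · simp [h]
    · simpa [h] using hlt e (by omega)
  · have hex : (∃ e < σ.nreg 1 + 1, Function.update (σ.narr 0) (σ.nreg 1) u e = x ∧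
        Function.update (σ.narr 1) (σ.nreg 1) v e = y) ↔
        (u = x ∧ v = y) ∨ ∃ e < σ.nreg 1, σ.narr 0 e = x ∧ σ.narr 1 e = y := by
      constructor
      · rintro ⟨e, he, hx, hy⟩
        by_cases h : e = σ.nreg 1
        · subst h
          simp only [Function.update_self] at hx hy
          exact Or.inl ⟨Fin.ext hx, Fin.ext hy⟩
        · simp only [Function.update_of_ne h] at hx hy
          exact Or.inr ⟨e, by omega, hx, hy⟩
      · rintro (⟨rfl, rfl⟩ | ⟨e, he, hx, hy⟩)
        · exact ⟨σ.nreg 1, by omega, by simp, by simp⟩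
        · exact ⟨e, by omega, by simp [he.ne, hx], by simp [he.ne, hy]⟩
    rw [hex, ← hmem]
    by_cases h : x = u
    · subst h
      simp [eq_comm]
    · simp [h, Ne.symm h]

/-- The state while the strategy of `u` is computed: the hub is `c`, the picks of `u` so far are
`T`, and the natural array `2` vanishes exactly at the live agents. -/
structure IsPicking (P : Fin n → EuclideanSpace ℝ (Fin d)) (c u : Fin n)
    (s : Fin n → Finset (Fin n)) (T : Finset (Fin n)) (σ : State) : Prop where
  env : IsEnv P σ
  agent : σ.nreg 3 = u
  hub : σ.nreg 5 = c
  outputs : σ.Outputs (Function.update s u ((if u = c then ∅ else {c}) ∪ T))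
  mark : ∀ w : Fin n, σ.narr 2 w = 0 ↔ IsLive P c u T w

variable {c u : Fin n} {s : Fin n → Finset (Fin n)} {T : Finset (Fin n)}

theorem IsPicking.congr (h : IsPicking P c u s T σ) {τ : State} (hτ : IsEnv P τ)
    (h1 : τ.nreg 1 = σ.nreg 1) (h3 : τ.nreg 3 = σ.nreg 3) (h5 : τ.nreg 5 = σ.nreg 5)
    (ha : τ.narr = σ.narr) : IsPicking P c u s T τ :=
  ⟨hτ, h3.trans h.agent, h5.trans h.hub, h.outputs.congr h1 (by rw [ha]) (by rw [ha]),
    by rw [ha]; exact h.mark⟩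

/-- Buy the edge to the hub and mark the agents that are too far to be live. -/
def initProg (d : ℕ) : Prog :=
  .seq (distProg 3 5 d) <| (Instr.radd 6 1 1).andThen <| (Instr.radd 6 6 6).andThen <|
  -- Real register `6` holds four times the distance to the hub; for distinct points it is positive
  -- exactly when the agent is not the hub.
  .seq (.ite (.rlt 7 6) (appendProg 5) .skip) <|
  .for 4 <| .seq (distProg 3 4 d) <| (Instr.nstore 2 4 2).andThen <|
    .ite (.rlt 7 1) (.ite (.rlt 1 6) (.instr (.nstore 2 4 9)) .skip)
      .skip

theorem exec_initProg (hP : Function.Injective P) (hσ : IsEnv P σ) (hu : σ.nreg 3 = u)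
    (hc : σ.nreg 5 = c) (ho : σ.Outputs s) (hs : s u = ∅) :
    Exec (initProg d) σ (distTime d + (1 + (1 + ((1 + (1 + (1 + 1))) +
      (n * (distTime d + (1 + (1 + (1 + 1))) + 2) + 2))))) (IsPicking P c u s ∅) := by
  refine Exec.seq <| exec_distProg hσ hu hc fun ρ h1 hρ => Exec.andThen <| Exec.andThen <|
    Exec.seq ?_
  have hloop : ∀ τ : State, IsEnv P τ → τ.nreg 3 = u → τ.nreg 5 = c →
      τ.rreg 6 = 4 * l1Dist P u c →
      τ.Outputs (Function.update s u ((if u = c then ∅ else {c}) ∪ ∅)) →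
      Exec (.for 4 <| .seq (distProg 3 4 d) <| (Instr.nstore 2 4 2).andThen <|
        .ite (.rlt 7 1) (.ite (.rlt 1 6) (.instr (.nstore 2 4 9)) .skip)
          .skip) τ
        (n * (distTime d + (1 + (1 + (1 + 1))) + 2) + 2) (IsPicking P c u s ∅) := by
    intro τ hτ h3 h5 h6 hout
    refine Exec.for (fun k τ => IsEnv P τ ∧ τ.nreg 4 = k ∧ τ.nreg 3 = u ∧ τ.nreg 5 = c ∧
      τ.rreg 6 = 4 * l1Dist P u c ∧
      τ.Outputs (Function.update s u ((if u = c then ∅ else {c}) ∪ ∅)) ∧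
      ∀ w : Fin n, w.val < k → (τ.narr 2 w = 0 ↔ IsLive P c u ∅ w)) ?_ ?_ ?_ ?_
    · exact fun k τ h => ⟨h.2.1, h.1.size⟩
    · exact ⟨hτ.congr rfl rfl rfl rfl rfl, by simp [Instr.exec], h3, h5, h6,
        hout.congr rfl rfl rfl, by simp⟩
    · clear! τ
      rintro k τ hk ⟨hτ, h4, h3, h5, h6, hout, hmark⟩
      refine Exec.seq <| exec_distProg hτ h3 (v := ⟨k, hk⟩) h4 fun ρ h1 hρ => ?_
      have hρ6 := hρ 6 (by decide) (by decide) (by decide)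
      have hρ7 := hρ 7 (by decide) (by decide) (by decide)
      rw [hτ.rzero] at hρ7
      rw [h6] at hρ6
      have hlive : IsLive P c u ∅ ⟨k, hk⟩ ↔
          0 < l1Dist P u ⟨k, hk⟩ ∧ l1Dist P u ⟨k, hk⟩ < 4 * l1Dist P u c := by simp [IsLive]
      have hcase : ∀ w : Fin n, w.val < k + 1 → w.val < k ∨ w = ⟨k, hk⟩ := fun w hw => by
        rcases Nat.lt_succ_iff_lt_or_eq.1 hw with h | h
        · exact Or.inl h
        · exact Or.inr (Fin.ext h)
      refine Exec.andThen <| Exec.ite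
        (fun hb => Exec.ite (fun hb' => Exec.instr ?_) fun hb' => Exec.skip ?_)
        fun hb => Exec.skip ?_
      all_goals
        refine ⟨hτ.congr rfl rfl rfl ?_ rfl, ?_, h3, h5, ?_, hout.congr rfl ?_ ?_,
          fun w hw => ?_⟩
        · simp [Instr.exec, hρ7, hτ.rzero]
        · simp [Instr.exec, h4, hτ.one]
        · simp [Instr.exec, hρ6]
        · simp [Instr.exec]
        · simp [Instr.exec]
        · simp [Instr.exec, Test.Holds, h1, hρ7] at hb
          try simp [Instr.exec, Test.Holds, h1, hρ6] at hb'
          rcases hcase w hw with h | rfl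
          · simpa [Instr.exec, h4, h.ne] using hmark w h
          · rw [hlive]
            simp [Instr.exec, h4, hτ.one, hτ.nzero, hb]
            try assumption
    · rintro τ ⟨hτ, -, h3, h5, -, hout, hmark⟩
      exact ⟨hτ, h3, h5, hout, fun w => hmark w w.2⟩
  have hρ7 := hρ 7 (by decide) (by decide) (by decide)
  rw [hσ.rzero] at hρ7
  have h4 : l1Dist P u c + l1Dist P u c + (l1Dist P u c + l1Dist P u c) = 4 * l1Dist P u c := by
    ring
  refine Exec.ite (fun hb => ?_) fun hb => Exec.skip ?_
  · simp [Instr.exec, Test.Holds, h1, hρ7, h4] at hb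
    have huc : u ≠ c := by
      rintro rfl
      simp [l1Dist_self] at hb
    refine exec_appendProg (s := s) (u := u) (v := c) ?_ ?_ ?_ ?_ fun a ha hout =>
      hloop _ (hσ.congr ?_ ?_ ?_ ?_ rfl) ?_ ?_ ?_ ?_
    · exact ho.congr rfl rfl rfl
    · exact hσ.one
    · exact hu
    · exact hc
    · simp [Instr.exec]
    · simp [Instr.exec]
    · simp [Instr.exec]
    · simp [Instr.exec, hρ7, hσ.rzero]
    · simp [Instr.exec, hu]
    · simp [Instr.exec, hc]
    · simp [Instr.exec, h1, h4]
    · simpa [huc, hs] using hout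
  · simp [Instr.exec, Test.Holds, h1, hρ7, h4] at hb
    have huc : u = c := by
      by_contra huc
      exact absurd (l1Dist_pos hP huc) (not_lt.2 hb)
    refine hloop _ (hσ.congr rfl rfl rfl ?_ rfl) hu hc ?_ ?_
    · simp [Instr.exec, hρ7, hσ.rzero]
    · simp [Instr.exec, h1, h4]
    · have : Function.update s u ((if u = c then ∅ else {c}) ∪ ∅) = s := by
        rw [if_pos huc, Finset.union_empty, ← hs, Function.update_eq_self]
      rw [this]
      exact ho.congr rfl rfl rfl

/-- Natural register `6` receives a live agent nearest to the agent number `nreg 3`, and natural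
register `7` tells whether there is one. -/
def findProg (d : ℕ) : Prog :=
  (Instr.nconst 7 0).andThen <| .for 4 <| (Instr.nload 8 2 4).andThen <| .seq (distProg 3 4 d) <|
    .ite (.nlt 9 8) .skip <|
    .ite (.rlt 1 3) ((Instr.radd 3 1 7).andThen <| (Instr.nadd 6 4 9).andThen <|
      .instr (.nadd 7 2 9)) <|
    -- A live agent not closer than real register `3` is still taken if nothing has been found,
    -- since that register is then stale.
    .ite (.nlt 9 7) .skip <|
    (Instr.radd 3 1 7).andThen <| (Instr.nadd 6 4 9).andThen <| .instr (.nadd 7 2 9)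

theorem exec_findProg (hσ : IsPicking P c u s T σ) :
    Exec (findProg d) σ (1 + (n * (1 + (distTime d + (1 + (1 + (1 + (1 + (1 + 1)))))) + 2) + 2))
      fun τ => IsPicking P c u s T τ ∧ ((τ.nreg 7 = 0 ∧ ∀ w, ¬ IsLive P c u T w) ∨
        (τ.nreg 7 = 1 ∧ ∃ v : Fin n, τ.nreg 6 = v ∧ τ.rreg 3 = l1Dist P u v ∧ IsLive P c u T v ∧
          ∀ w, IsLive P c u T w → l1Dist P u v ≤ l1Dist P u w)) := by
  refine Exec.andThen <| Exec.for (fun k τ => IsPicking P c u s T τ ∧ τ.nreg 4 = k ∧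
    ((τ.nreg 7 = 0 ∧ ∀ w : Fin n, w.val < k → ¬ IsLive P c u T w) ∨
      (τ.nreg 7 = 1 ∧ ∃ v : Fin n, τ.nreg 6 = v ∧ τ.rreg 3 = l1Dist P u v ∧ IsLive P c u T v ∧
        ∀ w : Fin n, w.val < k → IsLive P c u T w → l1Dist P u v ≤ l1Dist P u w))) ?_ ?_ ?_ ?_
  · exact fun k τ h => ⟨h.2.1, h.1.env.size⟩
  · exact ⟨hσ.congr (hσ.env.congr rfl rfl rfl rfl rfl) rfl rfl rfl rfl, by simp [Instr.exec]⟩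
  · rintro k τ hk ⟨hτ, h4, hI⟩
    have hcase : ∀ w : Fin n, w.val < k + 1 → w.val < k ∨ w = ⟨k, hk⟩ := fun w hw => by
      rcases Nat.lt_succ_iff_lt_or_eq.1 hw with h | h
      · exact Or.inl h
      · exact Or.inr (Fin.ext h)
    refine Exec.andThen <| Exec.seq <| exec_distProg (u := u) (v := ⟨k, hk⟩)
      (a := 3) (b := 4) (σ := (Instr.nload 8 2 4).exec τ)
      (hτ.env.congr rfl rfl rfl rfl rfl) hτ.agent h4
      fun ρ h1 hρ => ?_
    have hρ3 : ρ 3 = τ.rreg 3 := hρ 3 (by decide) (by decide) (by decide)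
    have hρ7 : ρ 7 = 0 := (hρ 7 (by decide) (by decide) (by decide)).trans hτ.env.rzero
    have hm : τ.narr 2 (τ.nreg 4) = 0 ↔ IsLive P c u T ⟨k, hk⟩ := by
      rw [h4]
      exact hτ.mark ⟨k, hk⟩
    have take : IsLive P c u T ⟨k, hk⟩ →
        (τ.nreg 7 = 1 → l1Dist P u ⟨k, hk⟩ ≤ τ.rreg 3) →
        Exec ((Instr.radd 3 1 7).andThen <| (Instr.nadd 6 4 9).andThen <| .instr (.nadd 7 2 9))
          { (Instr.nload 8 2 4).exec τ with rreg := ρ } (1 + (1 + 1)) fun υ =>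
          IsPicking P c u s T ((Instr.nadd 4 4 2).exec υ) ∧
          ((Instr.nadd 4 4 2).exec υ).nreg 4 = k + 1 ∧
          ((((Instr.nadd 4 4 2).exec υ).nreg 7 = 0 ∧
            ∀ w : Fin n, w.val < k + 1 → ¬ IsLive P c u T w) ∨
          (((Instr.nadd 4 4 2).exec υ).nreg 7 = 1 ∧ ∃ v : Fin n,
            ((Instr.nadd 4 4 2).exec υ).nreg 6 = v ∧
            ((Instr.nadd 4 4 2).exec υ).rreg 3 = l1Dist P u v ∧ IsLive P c u T v ∧
            ∀ w : Fin n, w.val < k + 1 → IsLive P c u T w → l1Dist P u v ≤ l1Dist P u w)) := by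
      intro hl hle
      refine Exec.andThen <| Exec.andThen <| Exec.instr
        ⟨hτ.congr (hτ.env.congr rfl rfl rfl ?_ rfl) rfl rfl rfl rfl, ?_,
          Or.inr ⟨?_, ⟨k, hk⟩, ?_, ?_, hl, fun w hw hwl => ?_⟩⟩
      · simp [Instr.exec, hρ7, hτ.env.rzero]
      · simp [Instr.exec, h4, hτ.env.one]
      · simp [Instr.exec, hτ.env.one, hτ.env.nzero]
      · simp [Instr.exec, h4, hτ.env.nzero]
      · simp [Instr.exec, h1, hρ7]
      · rcases hcase w hw with h | rfl
        · rcases hI with ⟨-, hno⟩ | ⟨h7, v, -, h3, -, hmin⟩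
          · exact absurd hwl (hno w h)
          · exact ((hle h7).trans_eq h3).trans (hmin w h hwl)
        · exact le_rfl
    have keep : (IsLive P c u T ⟨k, hk⟩ → τ.nreg 7 = 1 ∧ τ.rreg 3 ≤ l1Dist P u ⟨k, hk⟩) →
        Exec .skip { (Instr.nload 8 2 4).exec τ with rreg := ρ } 1 fun υ =>
          IsPicking P c u s T ((Instr.nadd 4 4 2).exec υ) ∧
          ((Instr.nadd 4 4 2).exec υ).nreg 4 = k + 1 ∧
          ((((Instr.nadd 4 4 2).exec υ).nreg 7 = 0 ∧
            ∀ w : Fin n, w.val < k + 1 → ¬ IsLive P c u T w) ∨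
          (((Instr.nadd 4 4 2).exec υ).nreg 7 = 1 ∧ ∃ v : Fin n,
            ((Instr.nadd 4 4 2).exec υ).nreg 6 = v ∧
            ((Instr.nadd 4 4 2).exec υ).rreg 3 = l1Dist P u v ∧ IsLive P c u T v ∧
            ∀ w : Fin n, w.val < k + 1 → IsLive P c u T w → l1Dist P u v ≤ l1Dist P u w)) := by
      intro hle
      refine Exec.skip
        ⟨hτ.congr (hτ.env.congr rfl rfl rfl ?_ rfl) rfl rfl rfl rfl, ?_, ?_⟩
      · simp [Instr.exec, hρ7, hτ.env.rzero]
      · simp [Instr.exec, h4, hτ.env.one]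
      · refine hI.imp ?_ ?_
        · rintro ⟨h7, hno⟩
          refine ⟨by simpa [Instr.exec] using h7, fun w hw hwl => ?_⟩
          rcases hcase w hw with h | rfl
          · exact hno w h hwl
          · exact absurd h7 (by rw [(hle hwl).1]; decide)
        · rintro ⟨h7, v, h6, h3, hv, hmin⟩
          refine ⟨by simpa [Instr.exec] using h7, v, by simpa [Instr.exec] using h6,
            by simpa [Instr.exec, hρ3] using h3, hv, fun w hw hwl => ?_⟩
          rcases hcase w hw with h | rfl
          · exact hmin w h hwl
          · exact h3.symm.trans_le (hle hwl).2
    refine Exec.ite (b := .nlt 9 8) (fun hb => (keep fun hl => ?_).mono (by omega) fun _ h => h)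
      fun hb => Exec.ite (b := .rlt 1 3)
        (fun hb' => (take ?_ fun _ => ?_).mono (by omega) fun _ h => h)
        fun hb' => Exec.ite (b := .nlt 9 7)
          (fun hb'' => (keep fun _ => ⟨?_, ?_⟩).mono (by omega) fun _ h => h)
          fun hb'' => take ?_ fun h7 => ?_
    all_goals
      simp [Instr.exec, Test.Holds, hτ.env.nzero] at hb
    · rw [← hm] at hl
      omega
    · exact hm.1 hb
    · simp [Test.Holds, h1, hρ3] at hb'
      exact hb'.le
    · simp [Instr.exec, Test.Holds, hτ.env.nzero] at hb''
      rcases hI with hI | hI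
      · omega
      · exact hI.1
    · simpa [Test.Holds, h1, hρ3] using hb'
    · exact hm.1 hb
    · simp [Instr.exec, Test.Holds, hτ.env.nzero, h7] at hb''
  · rintro τ ⟨hτ, -, h⟩
    refine ⟨hτ, h.imp (fun h => ⟨h.1, fun w => h.2 w w.2⟩) ?_⟩
    rintro ⟨h7, v, h6, h3, hv, hmin⟩
    exact ⟨h7, v, h6, h3, hv, fun w => hmin w w.2⟩

/-- Buy the edge from the agent number `nreg 3` to the agent number `nreg 6` and mark the agents
covered by it. -/
def pickProg (d : ℕ) : Prog :=
  .seq (appendProg 6) <| .for 4 <| .seq (distProg 6 4 d) <| (Instr.radd 8 1 1).andThen <|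
    (Instr.radd 8 8 3).andThen <| .seq (distProg 3 4 d) <| (Instr.radd 9 1 1).andThen <|
    -- The test is the negation of `Covers`, with its two sides in real registers `8` and `9`.
    .ite (.rlt 9 8) .skip (.instr (.nstore 2 4 2))

theorem exec_pickProg (hσ : IsPicking P c u s T σ) {v : Fin n} (h6 : σ.nreg 6 = v)
    (h3 : σ.rreg 3 = l1Dist P u v) :
    Exec (pickProg d) σ (1 + (1 + 1) +
      (n * (distTime d + (1 + (1 + (distTime d + (1 + (1 + 1))))) + 2) + 2))
      (IsPicking P c u s (insert v T)) := by
  refine Exec.seq <| exec_appendProg hσ.outputs hσ.env.one hσ.agent h6 fun a ha hout => ?_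
  refine Exec.for (fun k τ => IsEnv P τ ∧ τ.nreg 4 = k ∧ τ.nreg 3 = u ∧ τ.nreg 5 = c ∧
    τ.nreg 6 = v ∧ τ.rreg 3 = l1Dist P u v ∧
    τ.Outputs (Function.update s u ((if u = c then ∅ else {c}) ∪ insert v T)) ∧
    ∀ w : Fin n, τ.narr 2 w = 0 ↔
      IsLive P c u T w ∧ (w.val < k → ¬ Covers P u v w)) ?_ ?_ ?_ ?_
  · exact fun k τ h => ⟨h.2.1, h.1.size⟩
  · refine ⟨hσ.env.congr ?_ ?_ ?_ rfl rfl, ?_, ?_, ?_, ?_, h3, ?_, fun w => ?_⟩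
    · simp [Instr.exec]
    · simp [Instr.exec]
    · simp [Instr.exec]
    · simp [Instr.exec]
    · simp [Instr.exec, hσ.agent]
    · simp [Instr.exec, hσ.hub]
    · simp [Instr.exec, h6]
    · rw [Finset.union_insert]
      rw [Function.update_self, Function.update_idem] at hout
      exact hout.congr rfl rfl rfl
    · simpa [Instr.exec, ha] using hσ.mark w
  · clear! σ
    rintro k τ hk ⟨hτ, h4, h3, h5, h6, hr3, hout, hmark⟩
    refine Exec.seq <| exec_distProg hτ h6 (v := ⟨k, hk⟩) h4 fun ρ h1 hρ => Exec.andThen <|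
      Exec.andThen <| Exec.seq <| exec_distProg (P := P) (u := u) (v := ⟨k, hk⟩)
        ?_ ?_ ?_ fun ρ' h1' hρ' => Exec.andThen <|
      Exec.ite (fun hb => Exec.skip ?_) fun hb => Exec.instr ?_
    · exact hτ.congr rfl rfl rfl (by simp [Instr.exec, hρ]) rfl
    · exact h3
    · exact h4
    all_goals
      simp [Instr.exec, Test.Holds, h1', hρ', h1, hρ, hr3, ← two_mul] at hb
      refine ⟨hτ.congr rfl rfl rfl ?_ rfl, ?_, h3, h5, h6, ?_, hout.congr rfl ?_ ?_,
        fun w => ?_⟩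
      · simp [Instr.exec, hρ, hρ']
      · simp [Instr.exec, h4, hτ.one]
      · simp [Instr.exec, hρ, hρ', hr3]
      · simp [Instr.exec]
      · simp [Instr.exec]
      · rcases eq_or_ne w ⟨k, hk⟩ with rfl | hne
        · simp [Instr.exec, h4, hτ.one, Covers, hb] <;> simpa using hmark ⟨k, hk⟩
        · have hne' : w.val ≠ k := fun h => hne (Fin.ext h)
          have hlt : w.val < k + 1 ↔ w.val < k := by omega
          simp [Instr.exec, h4, hne', hlt, hmark]
  · rintro τ ⟨hτ, -, h3, h5, -, -, hout, hmark⟩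
    refine ⟨hτ, h3, h5, hout, fun w => ?_⟩
    rw [hmark, isLive_insert]
    simp

/-- Compute the strategy of the agent number `nreg 3`. -/
def agentProg (d : ℕ) : Prog :=
  .seq (initProg d) <| Prog.repeat (.seq (findProg d) (.ite (.nlt 9 7) (pickProg d) .skip))
    ((4 * d + 1) ^ d)

/-- `agentProg d` takes at most `agentTime d * n` steps on `n` points. -/
def agentTime (d : ℕ) : ℕ :=
  (2 * distTime d + 14) + ((4 * d + 1) ^ d * (3 * distTime d + 26) + 1)

theorem exec_agentProg (hn : 1 ≤ n) (hP : Function.Injective P) (hσ : IsEnv P σ)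
    (hu : σ.nreg 3 = u) (hc : σ.nreg 5 = c) (ho : σ.Outputs s) (hs : s u = ∅) :
    Exec (agentProg d) σ (agentTime d * n) fun τ => IsEnv P τ ∧ τ.nreg 3 = u ∧ τ.nreg 5 = c ∧
      ∃ S, τ.Outputs (Function.update s u S) ∧ IsHubStrategy P c u ((4 * d + 1) ^ d + 1) S := by
  -- A round either adds a pick or finds nothing live. After `(4 * d + 1) ^ d` rounds both
  -- alternatives leave nothing live, so the number of rounds can be fixed in the program.
  have hround : ∀ k τ, (∃ T, IsPicking P c u s T τ ∧ IsGreedy P c u T ∧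
      (T.card = k ∨ ∀ w, ¬ IsLive P c u T w)) →
      Exec (.seq (findProg d) (.ite (.nlt 9 7) (pickProg d) .skip)) τ
        ((3 * distTime d + 26) * n) fun τ => ∃ T, IsPicking P c u s T τ ∧ IsGreedy P c u T ∧
          (T.card = k + 1 ∨ ∀ w, ¬ IsLive P c u T w) := by
    rintro k τ ⟨T, hτ, hT, hk⟩
    refine (Exec.seq (T₂ := 1 + (1 + (1 + 1) +
      (n * (distTime d + (1 + (1 + (distTime d + (1 + (1 + 1))))) + 2) + 2)))
      ((exec_findProg hτ).mono le_rfl ?_)).mono ?_ fun _ h => h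
    · rintro υ ⟨hυ, hfound⟩
      refine Exec.ite (fun hb => ?_) fun hb => Exec.skip ?_
      · simp only [Test.Holds, hυ.env.nzero] at hb
        rcases hfound with ⟨h7, -⟩ | ⟨-, v, h6, h3, hv, hmin⟩
        · omega
        refine (exec_pickProg hυ h6 h3).mono le_rfl fun ω hω =>
          ⟨insert v T, hω, hT.insert hv hmin, Or.inl ?_⟩
        rw [Finset.card_insert_of_notMem hv.notMem]
        rcases hk with hk | hk
        · rw [hk]
        · exact absurd hv (hk v)
      · simp only [Test.Holds, hυ.env.nzero] at hb
        rcases hfound with ⟨-, hno⟩ | ⟨h7, -⟩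
        · exact ⟨T, hυ, hT, Or.inr hno⟩
        · omega
    · nlinarith
  refine (Exec.seq ((exec_initProg hP hσ hu hc ho hs).mono le_rfl fun τ hτ =>
    (Exec.repeat (fun k τ => ∃ T, IsPicking P c u s T τ ∧ IsGreedy P c u T ∧
      (T.card = k ∨ ∀ w, ¬ IsLive P c u T w)) ⟨∅, hτ, isGreedy_empty, Or.inl rfl⟩ hround
      ((4 * d + 1) ^ d)).mono le_rfl fun υ hυ => ?_)).mono ?_ fun _ h => h
  · obtain ⟨T, hυ, hT, hk⟩ := hυ
    have hlive : ∀ w, ¬ IsLive P c u T w := hk.elim hT.not_isLive id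
    exact ⟨hυ.env, hυ.agent, hυ.hub, _, hυ.outputs, hT.isHubStrategy hP hlive⟩
  · rw [agentTime, add_mul _ (_ * _ + 1), add_mul (_ * _) 1]
    refine add_le_add ?_ (add_le_add (mul_assoc _ _ _).ge ?_)
    · nlinarith
    · omega

/-! ### The whole algorithm and its running time. -/

/-- Compute an approximate equilibrium of the points in the real arrays. -/
def networkProg (d : ℕ) : Prog :=
  (Instr.nconst 2 1).andThen <| (Instr.nconst 9 0).andThen <| (Instr.rconst 7 0).andThen <|
  .seq (hubProg d) <| (Instr.nconst 1 0).andThen <| .for 3 (agentProg d)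

/-- `networkProg d` takes at most `networkTime d * n ^ 2` steps on `n` points. -/
def networkTime (d : ℕ) : ℕ := distTime d + agentTime d + 24

theorem exec_networkProg (P : Fin n → EuclideanSpace ℝ (Fin d)) (α : ℝ) (hn : 1 ≤ n)
    (hP : Function.Injective P) :
    Exec (networkProg d) (input P α) (networkTime d * n ^ 2) fun τ => ∃ c s, τ.Outputs s ∧
      (∀ u, ∑ v, l1Dist P c v ≤ ∑ v, l1Dist P u v) ∧
      ∀ u, IsHubStrategy P c u ((4 * d + 1) ^ d + 1) (s u) := by
  refine Exec.mono (T := 1 + (1 + (1 + (n * (1 + (n * (distTime d + 1 + 2) + 2) +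
    (1 + (1 + (1 + 1))) + 2) + 2 + (1 + (n * (agentTime d * n + 2) + 2)))))) ?_ ?_ fun _ h => h
  · refine Exec.andThen <| Exec.andThen <| Exec.andThen <| Exec.seq <|
      (exec_hubProg (P := P) ?_ hn).mono le_rfl ?_
    · constructor <;> simp [Instr.exec, input]
    rintro τ ⟨hτ, c, hc, hmin⟩
    -- Agents not yet treated own no edges, as `exec_agentProg` requires.
    refine Exec.andThen <| Exec.for (fun k τ => IsEnv P τ ∧ τ.nreg 3 = k ∧ τ.nreg 5 = c ∧
      ∃ s, τ.Outputs s ∧ (∀ u : Fin n, u.val < k →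
        IsHubStrategy P c u ((4 * d + 1) ^ d + 1) (s u)) ∧ ∀ u : Fin n, k ≤ u.val → s u = ∅)
      ?_ ?_ ?_ ?_
    · exact fun k τ h => ⟨h.2.1, h.1.size⟩
    · refine ⟨hτ.congr rfl rfl rfl rfl rfl, ?_, hc, fun _ => ∅, ?_, ?_, fun _ _ => rfl⟩
      · simp [Instr.exec]
      · simp [State.Outputs, Instr.exec]
      · simp
    · clear! τ
      rintro k τ hk ⟨hτ, h3, h5, s, hout, hdone, htodo⟩
      refine (exec_agentProg hn hP hτ (u := ⟨k, hk⟩) h3 h5 hout (htodo _ le_rfl)).mono le_rfl ?_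
      rintro υ ⟨hυ, hυ3, hυ5, S, hυo, hS⟩
      refine ⟨hυ.congr rfl rfl rfl rfl rfl, ?_, hυ5, _, hυo.congr rfl rfl rfl,
        fun u hu => ?_, fun u hu => ?_⟩
      · simp [Instr.exec, hυ3, hυ.one]
      · rcases eq_or_ne u ⟨k, hk⟩ with rfl | hne
        · simpa using hS
        · rw [Function.update_of_ne hne]
          exact hdone u (lt_of_le_of_ne (Nat.lt_succ_iff.1 hu) fun h => hne (Fin.ext h))
      · have hne : u ≠ ⟨k, hk⟩ := by
          rintro rfl
          simp at hu
        rw [Function.update_of_ne hne]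
        exact htodo u (by omega)
    · rintro υ ⟨-, -, -, s, hout, hdone, -⟩
      exact ⟨c, s, hout, hmin, fun u => hdone u u.2⟩
  · have h1 : n ≤ n ^ 2 := Nat.le_self_pow two_ne_zero n
    rw [networkTime]
    nlinarith

end RealRAM

/-! ### From `α / n` to the stated exponents. -/

/-- For `α ≤ n ^ x`, the ratio `α / n` is at most `α ^ y + 1` as soon as `1 - 1 / x ≤ y`. -/
theorem div_le_rpow_add_one {n : ℕ} {α x y : ℝ} (hn : 1 ≤ n) (hα : 0 < α) (hx : 0 < x)
    (h : α ≤ (n : ℝ) ^ x) (hy : 1 - 1 / x ≤ y) : α / n ≤ α ^ y + 1 := by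
  have hn1 : (1 : ℝ) ≤ n := by exact_mod_cast hn
  have hn0 : (0 : ℝ) < n := by linarith
  have hpos := Real.rpow_pos_of_pos hα y
  rcases le_total α 1 with h1 | h1
  · have := div_le_self hα.le hn1
    linarith
  · have hroot : α ^ (1 / x) ≤ n := by
      rw [one_div]
      exact (Real.rpow_inv_le_iff_of_pos hα.le hn0.le hx).2 h
    have h2 : α / n ≤ α / α ^ (1 / x) :=
      div_le_div_of_nonneg_left hα.le (Real.rpow_pos_of_pos hα _) hroot
    have h3 : α / α ^ (1 / x) = α ^ (1 - 1 / x) := by rw [Real.rpow_sub hα, Real.rpow_one]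
    have h4 := Real.rpow_le_rpow_of_exponent_le h1 hy
    linarith

theorem mainTheorem2 (d : ℕ) :
    ∃ (A : RealRAM.Prog) (C : ℝ),
      ∀ (n : ℕ) (P : Fin n → EuclideanSpace ℝ (Fin d)) (α : ℝ),
        1 ≤ n → Function.Injective P → 0 < α →
        ∃ (t : ℕ) (σ : RealRAM.State) (s : Fin n → Finset (Fin n)),
          RealRAM.Run A (RealRAM.input P α) t σ ∧
          (t : ℝ) ≤ C * (n : ℝ) ^ 2 ∧
          σ.Outputs s ∧
          NetworkCreation.IsStrategyProfile s ∧
          (∀ x : ℝ, 1 ≤ x → α ≤ (n : ℝ) ^ x →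
            ∃ β : ℝ, β ≤ C * (α ^ (1 - 1 / (2 * x)) + 1) ∧
              NetworkCreation.IsBetaGammaNE P α β β s) ∧
          (∀ x : ℝ, 0 < x → x < 1 → α ≤ (n : ℝ) ^ x →
            ∃ β : ℝ, β ≤ C * (α ^ ((3 * x - 1) / (4 * x)) + 1) ∧
              NetworkCreation.IsBetaGammaNE P α β β s) ∧
          (α ≤ (n : ℝ) ^ (1 / 3 : ℝ) →
            ∃ β : ℝ, β ≤ C ∧ NetworkCreation.IsBetaGammaNE P α β β s) := by
  obtain ⟨K, hK⟩ : ∃ K : ℕ, K = (4 * d + 1) ^ d + 1 := ⟨_, rfl⟩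
  refine ⟨RealRAM.networkProg d, RealRAM.networkTime d + d * (8 * K + 2),
    fun n P α hn hP hα => ?_⟩
  obtain ⟨t, σ, ht, hrun, c, s, hout, hmin, hS⟩ := RealRAM.exec_networkProg P α hn hP
  rw [← hK] at hS
  have hNE := NetworkCreation.isBetaGammaNE_of_isHubStrategy hP hS hmin hα hn
  have hn1 : (1 : ℝ) ≤ n := by exact_mod_cast hn
  have htime : (0 : ℝ) ≤ RealRAM.networkTime d := Nat.cast_nonneg _
  -- The constant is the sum of the time constant and the ratio constant, so it serves both
  -- purposes; only `max 1 (α / n)` matters for the ratio.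
  have hβ : ∀ b : ℝ, 1 ≤ b → α / n ≤ b →
      d * (8 * K * (α / n) + 2) ≤ (RealRAM.networkTime d + d * (8 * K + 2) : ℝ) * b := by
    intro b hb hle
    have h1 : 8 * K * (α / n) + 2 ≤ (8 * K + 2) * b := by
      have := mul_le_mul_of_nonneg_left hle (show (0 : ℝ) ≤ 8 * K by positivity)
      linarith
    have h2 := mul_le_mul_of_nonneg_left h1 (Nat.cast_nonneg (α := ℝ) d)
    have h3 : 0 ≤ (RealRAM.networkTime d : ℝ) * b := by positivity
    linarith
  -- For `x ≤ 1` the ratio is bounded outright, which is stronger than the exponent `(3 * x - 1) /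
  -- (4 * x)` asks.
  have hsmall : ∀ x : ℝ, 0 < x → x ≤ 1 → α ≤ (n : ℝ) ^ x → α / n ≤ 1 := by
    intro x _ hx1 h
    rw [div_le_one (by linarith)]
    exact h.trans ((Real.rpow_le_rpow_of_exponent_le hn1 hx1).trans_eq (Real.rpow_one _))
  refine ⟨t, σ, s, hrun, ?_, hout, fun u => (hS u).notMem, fun x hx h => ⟨_, hβ _ ?_ ?_, hNE⟩,
    fun x hx hx1 h => ⟨_, hβ _ ?_ ?_, hNE⟩, fun h => ⟨_, ?_, hNE⟩⟩
  · have h1 : (t : ℝ) ≤ RealRAM.networkTime d * (n : ℝ) ^ 2 := by exact_mod_cast ht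
    have h2 : (0 : ℝ) ≤ d * (8 * K + 2) * (n : ℝ) ^ 2 := by positivity
    linarith
  · linarith [Real.rpow_pos_of_pos hα (1 - 1 / (2 * x))]
  · refine div_le_rpow_add_one hn hα (by linarith) h (sub_le_sub_left ?_ 1)
    exact one_div_le_one_div_of_le (by linarith) (by linarith)
  · linarith [Real.rpow_pos_of_pos hα ((3 * x - 1) / (4 * x))]
  · linarith [hsmall x hx hx1.le h, Real.rpow_pos_of_pos hα ((3 * x - 1) / (4 * x))]
  · have := hβ 1 le_rfl (hsmall (1 / 3) (by norm_num) (by norm_num) h)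
    rwa [mul_one] at this
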